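/- Let $p\ge 0$, let $A\subseteq[p]=\{1,\dots,p\}$ and $B=[p]\setminus A$. The sparse one-factor analysis model with children $A$ and isolated nodes $B$ is the set $F_A$ of all covariance matrices $\Omega+\lambda\lambda^{\top}$, where $\Omega$ is a real diagonal $p\times p$ matrix with positive diagonal entries and $\lambda\in\mathbb R^p$ satisfies $\lambda_v=0$ for all $v\in B$. Its ideal of invariants is $$I_{A,B,1}=\{f\in\mathbb R[\sigma_{ij}: 1\le i<j\le p] : f(\Sigma)=0\text{ for all }\Sigma\in F_A\}.$$ Circular term orders: for $S\subseteq[p]$, place the vertices of $S$ in increasing order at the $|S|$-th roots of unity, and partition the edges $ij$ $(i<j,\ i,j\in S)$ of the complete graph on $S$ into classes, two edges being in the same class if their endpoints have the same distance along the polygon, that is, if they are equivalent under the dihedral group; a class is smaller than another if this distance is smaller. A term order on $\mathbb R[\sigma_{ij}: 1\le i<j\le p]$ is circular with respect to $S$ if, on monomials in the variables $\sigma_{ij}$ with $i,j\in S$, it is a block order whose blocks are these classes, variables of smaller classes being larger: two monomials are compared by their parts in the smallest class in which these parts differ. Let $\prec$ be a term order that is circular with respect to $[p]$ or circular with respect to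 $A$. Then the set of degree-one monomials and tetrads $$\{\sigma_{ij} : i<j,\ i\in B\text{ or }j\in B\}\ \cup\ \{\underline{\sigma_{ij}\sigma_{kl}}-\sigma_{ik}\sigma_{jl},\ \underline{\sigma_{il}\sigma_{jk}}-\sigma_{ik}\sigma_{jl} : i<j<k<l,\ i,j,k,l\in A\}$$ is a reduced Gröbner basis of $I_{A,B,1}$ with respect to $\prec$, and the underlined terms are the leading terms of the tetrads. -/

import Mathlib

namespace SparseFactor

open MvPolynomial
open scoped MonomialOrder

/-! ## The model and its ideal of invariants -/

/-- The covariance model of a factor analysis graph with observed nodes `Fin p`, latent nodes `H`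
and edges `D h v` (meaning `h → v`): all matrices `Ω + Λ Λᵀ` with `Ω` diagonal and positive
definite and `Λ` a real matrix supported on the edges. -/
def factorModel {p : ℕ} {H : Type} [Fintype H] (D : H → Fin p → Prop) :
    Set (Matrix (Fin p) (Fin p) ℝ) :=
  {S | ∃ ω : Fin p → ℝ, (∀ v, 0 < ω v) ∧
    ∃ Λ : Matrix (Fin p) H ℝ, (∀ v h, ¬ D h v → Λ v h = 0) ∧
      S = Matrix.diagonal ω + Λ * Λ.transpose}

/-- The pairs `i < j` of observed nodes: the edges of the complete graph on `Fin p`, and the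
indices of the indeterminates `σ_ij`. -/
abbrev Edge (p : ℕ) : Type := {e : Fin p × Fin p // e.1 < e.2}

/-- The ideal of invariants of a set of covariance matrices, as an ideal in the polynomial ring
`ℝ[σ_ij, i < j]` in the off-diagonal entries. -/
noncomputable def idealOfInvariants {p : ℕ} (F : Set (Matrix (Fin p) (Fin p) ℝ)) :
    Ideal (MvPolynomial (Edge p) ℝ) :=
  vanishingIdeal ℝ ((fun (S : Matrix (Fin p) (Fin p) ℝ) (e : Edge p) => S e.1.1 e.1.2) '' F)

/-- The ideal `I_{A,B,1}` of the sparse one-factor analysis model: there is one latent node, its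
set of children is `A`, and the nodes in `B = Aᶜ` are isolated. -/
noncomputable def oneFactorIdeal {p : ℕ} (A : Finset (Fin p)) :
    Ideal (MvPolynomial (Edge p) ℝ) :=
  idealOfInvariants (factorModel (H := Unit) (fun _ v => v ∈ A))

/-! ## Reduced Gröbner bases -/

/-- `G` is a Gröbner basis of `I` for the term order `m`: a finite subset of `I` whose leading
terms generate the initial ideal of `I`. -/
def IsGroebnerBasis {τ : Type*} {R : Type*} [CommSemiring R] (m : MonomialOrder τ)
    (G : Set (MvPolynomial τ R)) (I : Ideal (MvPolynomial τ R)) : Prop :=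
  G.Finite ∧ G ⊆ (I : Set (MvPolynomial τ R)) ∧
    Ideal.span (m.leadingTerm '' G) = Ideal.span (m.leadingTerm '' (I : Set (MvPolynomial τ R)))

/-- `G` is a reduced Gröbner basis of `I`: a Gröbner basis of nonzero polynomials with leading
coefficient `1`, such that no monomial of an element `g` of `G` is divisible by the leading
monomial of another element of `G`. (For exponent vectors, divisibility is `≤`.) -/
def IsReducedGroebnerBasis {τ : Type*} {R : Type*} [CommSemiring R] (m : MonomialOrder τ)
    (G : Set (MvPolynomial τ R)) (I : Ideal (MvPolynomial τ R)) : Prop :=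
  IsGroebnerBasis m G I ∧
    (∀ g ∈ G, g ≠ 0 ∧ m.leadingCoeff g = 1) ∧
    ∀ g ∈ G, ∀ g' ∈ G, g' ≠ g → ∀ u ∈ g.support, ¬ m.degree g' ≤ u

/-! ## Circular term orders -/

/-- The class of the edge `e` in the circular embedding of the complete graph on the vertex set
`S`, where the vertices of `S` are placed in increasing order at the `|S|`-th roots of unity.
If the endpoints of `e` lie `d` steps apart, counted in one direction, then they lie `|S| - d`
steps apart in the other, and two edges are equivalent under the dihedral group exactly if the
smaller of these two numbers agrees. The class is numbered `k` if it contains the edge between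
the first and the `k`-th vertex with `2 ≤ k ≤ |S| / 2 + 1`; it is the
smaller, the closer `e` is to the boundary of the polygon. -/
def edgeClass {p : ℕ} (S : Finset (Fin p)) (e : Edge p) : ℕ :=
  min (S.filter (fun v => e.1.1 ≤ v ∧ v < e.1.2)).card
    (S.card - (S.filter (fun v => e.1.1 ≤ v ∧ v < e.1.2)).card) + 1

/-- On the monomials in the variables from `T`, the term order `m` is a block order with blocks
`{t ∈ T | c t = k}`, the blocks being ordered so that a smaller `k` means larger variables: two
monomials are compared by their parts in the first block in which they differ. -/
def IsBlockOrderOn {τ : Type*} (m : MonomialOrder τ) (T : Set τ) (c : τ → ℕ) : Prop :=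
  ∀ (k : ℕ) (u v : τ →₀ ℕ), (u.support : Set τ) ⊆ T → (v.support : Set τ) ⊆ T →
    (∀ t, c t < k → u t = v t) →
    Finsupp.filter (fun t => c t = k) u ≺[m] Finsupp.filter (fun t => c t = k) v →
    u ≺[m] v

/-- `m` is a circular term order for the circular embedding of the complete graph on `S`: a block
order whose blocks are the classes of edges. In particular `σ_e ≻ σ_f` whenever the edge `e` is in
a smaller class than the edge `f`. If `S` is not the set of all vertices, nothing is
required of variables `σ_ij` with `i ∉ S` or `j ∉ S`. -/
def IsCircularTermOrder {p : ℕ} (S : Finset (Fin p)) (m : MonomialOrder (Edge p)) : Prop :=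
  IsBlockOrderOn m {e : Edge p | e.1.1 ∈ S ∧ e.1.2 ∈ S} (edgeClass S)

/-! ## Degree-one monomials and tetrads -/

/-- The indeterminate `σ_ij`, `i < j`. -/
noncomputable def sig {p : ℕ} (i j : Fin p) (h : i < j) : MvPolynomial (Edge p) ℝ :=
  X ⟨(i, j), h⟩

/-- The monomials `σ_ij` with `i ∈ B` or `j ∈ B`. -/
def degreeOneMonomials {p : ℕ} (B : Finset (Fin p)) : Set (MvPolynomial (Edge p) ℝ) :=
  {f | ∃ (i j : Fin p) (h : i < j), (i ∈ B ∨ j ∈ B) ∧ f = sig i j h}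

/-- The tetrad `σ_ij σ_kl - σ_ik σ_jl`, for `i < j < k < l`. -/
noncomputable def tetrad₁ {p : ℕ} (i j k l : Fin p) (hij : i < j) (hjk : j < k) (hkl : k < l) :
    MvPolynomial (Edge p) ℝ :=
  sig i j hij * sig k l hkl - sig i k (hij.trans hjk) * sig j l (hjk.trans hkl)

/-- The tetrad `σ_il σ_jk - σ_ik σ_jl`, for `i < j < k < l`. -/
noncomputable def tetrad₂ {p : ℕ} (i j k l : Fin p) (hij : i < j) (hjk : j < k) (hkl : k < l) :
    MvPolynomial (Edge p) ℝ :=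
  sig i l ((hij.trans hjk).trans hkl) * sig j k hjk -
    sig i k (hij.trans hjk) * sig j l (hjk.trans hkl)

/-- All tetrads on the node set `A`. -/
def tetrads {p : ℕ} (A : Finset (Fin p)) : Set (MvPolynomial (Edge p) ℝ) :=
  {f | ∃ (i j k l : Fin p) (hij : i < j) (hjk : j < k) (hkl : k < l),
    (i ∈ A ∧ j ∈ A ∧ k ∈ A ∧ l ∈ A) ∧
      (f = tetrad₁ i j k l hij hjk hkl ∨ f = tetrad₂ i j k l hij hjk hkl)}

end SparseFactor

namespace SparseFactor

open MvPolynomial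
open scoped MonomialOrder

variable {p : ℕ}

/-! ## Vertex degrees of edge multisets -/

/-! Off the diagonal, the matrices of the model have entries `t i * t j` with `t` zero outside `A`,
so the ideal is the kernel of the monomial map `parametrization` (`mem_oneFactorIdeal_iff`). This
map kills the edges that leave `A` and sends a multigraph on `A` to its degree sequence.

Each degree sequence belongs to at most one weakly crossing multigraph
(`WeaklyCrossing.eq_of_vertexDegree_eq`). Any other multigraph contains two separated or nested
edges. Trading them for the crossing pair on the same four vertices keeps the degrees and lowers the
monomial (`CrossingLT`, the only property of the term order that is used). Hence a weakly crossing
monomial is the least in its fibre.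

The leading monomial of a nonzero element of the ideal, if supported on `A`, must cancel under the
map against another monomial of its fibre, which is smaller. So it is not weakly crossing and is
divisible by the leading term of a tetrad. If it is not supported on `A`, a degree-one generator
divides it. No S-pairs are needed. -/

/-- The vertex degrees of the multigraph with edge multiplicities `u`. -/
noncomputable def vertexDegree : (Edge p →₀ ℕ) →ₗ[ℕ] (Fin p →₀ ℕ) :=
  Finsupp.linearCombination ℕ
    (fun e : Edge p => Finsupp.single e.1.1 1 + Finsupp.single e.1.2 1)

lemma vertexDegree_single (e : Edge p) (n : ℕ) :
    vertexDegree (Finsupp.single e n) =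
      n • (Finsupp.single e.1.1 1 + Finsupp.single e.1.2 1) := by
  simp [vertexDegree]

/-- Double counting: a statistic that gives each edge the sum of the weights of its endpoints
depends only on the vertex degrees. -/
lemma sum_edge_weight (u : Edge p →₀ ℕ) (g : Fin p → ℕ) :
    ∑ e, u e * (g e.1.1 + g e.1.2) = Finsupp.linearCombination ℕ g (vertexDegree u) := by
  rw [vertexDegree, Finsupp.linearCombination_apply ℕ u, Finsupp.sum_fintype _ _ (by simp), map_sum]
  refine Finset.sum_congr rfl fun e _ => ?_
  simp [mul_add]

lemma sum_edge_weight_congr {u v : Edge p →₀ ℕ} (h : vertexDegree u = vertexDegree v)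
    (g : Fin p → ℕ) :
    ∑ e, u e * (g e.1.1 + g e.1.2) = ∑ e, v e * (g e.1.1 + g e.1.2) := by
  rw [sum_edge_weight, sum_edge_weight, h]

/-! ## Weakly crossing edge multisets -/

/-- Any two edges of the support cross or share an endpoint. -/
def WeaklyCrossing (u : Edge p →₀ ℕ) : Prop :=
  ∀ e ∈ u.support, ∀ f ∈ u.support,
    e.1.1 ≤ f.1.2 ∧ (e.1.1 < f.1.1 → e.1.2 ≤ f.1.2)

/-- The number of edges with left endpoint at most `t`. -/
def leftCount (u : Edge p →₀ ℕ) (t : Fin p) : ℕ := ∑ e with e.1.1 ≤ t, u e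

/-- The number of edges with right endpoint at most `t`. -/
def rightCount (u : Edge p →₀ ℕ) (t : Fin p) : ℕ := ∑ e with e.1.2 ≤ t, u e

/-- A finitely supported function on a finite order is determined by its sums over lower sets. -/
lemma eq_of_sum_le_eq {α : Type*} [Fintype α] [PartialOrder α] [DecidableLE α]
    {u v : α → ℕ} (h : ∀ e, ∑ f with f ≤ e, u f = ∑ f with f ≤ e, v f) : u = v := by
  classical
  funext e
  induction e using WellFoundedLT.induction with
  | ind e ih =>
    have he : e ∈ Finset.univ.filter (fun f => f ≤ e) := by simp
    have h1 := h e
    rw [← Finset.add_sum_erase _ _ he, ← Finset.add_sum_erase _ _ he] at h1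
    have h2 : ∑ f ∈ (Finset.univ.filter (fun f => f ≤ e)).erase e, u f =
        ∑ f ∈ (Finset.univ.filter (fun f => f ≤ e)).erase e, v f := by
      refine Finset.sum_congr rfl fun f hf => ih f ?_
      simp only [Finset.mem_erase, Finset.mem_filter, Finset.mem_univ, true_and] at hf
      exact lt_of_le_of_ne hf.2 hf.1
    omega

lemma leftCount_add_rightCount_eq {u v : Edge p →₀ ℕ} (h : vertexDegree u = vertexDegree v)
    (t : Fin p) : leftCount u t + rightCount u t = leftCount v t + rightCount v t := by
  have := sum_edge_weight_congr h (fun i => if i ≤ t then 1 else 0)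
  simpa [mul_add, Finset.sum_add_distrib, leftCount, rightCount, Finset.sum_filter] using this

lemma sum_eq_of_vertexDegree_eq {u v : Edge p →₀ ℕ} (h : vertexDegree u = vertexDegree v) :
    ∑ e, u e = ∑ e, v e := by
  have := sum_edge_weight_congr h (fun _ => 1)
  rw [← Finset.sum_mul, ← Finset.sum_mul] at this
  omega

lemma leftCount_le_sum (u : Edge p →₀ ℕ) (t : Fin p) : leftCount u t ≤ ∑ e, u e :=
  Finset.sum_le_sum_of_subset (Finset.filter_subset _ _)

/-- Left endpoints of weakly crossing edges precede all right endpoints. -/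
lemma WeaklyCrossing.leftCount_eq {u : Edge p →₀ ℕ} (hu : WeaklyCrossing u) {t : Fin p}
    (ht : rightCount u t ≠ 0) : leftCount u t = ∑ e, u e := by
  obtain ⟨f, hf, hf0⟩ := Finset.exists_ne_zero_of_sum_ne_zero ht
  rw [leftCount, Finset.sum_filter]
  refine Finset.sum_congr rfl fun e _ => ?_
  split_ifs with h
  · rfl
  · by_contra h0
    exact h (((hu e (by simpa using Ne.symm h0) f (by simpa using hf0)).1).trans (by simpa using hf))

/-- Either no right endpoint is at most `t`, or all left endpoints are. So the left count can be
recovered from data that the vertex degrees determine. -/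
lemma WeaklyCrossing.leftCount_eq_min {u : Edge p →₀ ℕ} (hu : WeaklyCrossing u) (t : Fin p) :
    leftCount u t = min (leftCount u t + rightCount u t) (∑ e, u e) := by
  have h1 := leftCount_le_sum u t
  by_cases h : rightCount u t = 0
  · omega
  · have := hu.leftCount_eq h
    omega

/-- In a weakly crossing multiset, the edges are simultaneously sorted by both endpoints. -/
lemma WeaklyCrossing.sum_le_eq_min {u : Edge p →₀ ℕ} (hu : WeaklyCrossing u) (s t : Fin p) :
    ∑ e with e.1.1 ≤ s ∧ e.1.2 ≤ t, u e = min (leftCount u s) (rightCount u t) := by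
  have hl : ∑ e with e.1.1 ≤ s ∧ e.1.2 ≤ t, u e ≤ leftCount u s :=
    Finset.sum_le_sum_of_subset fun e => by simp +contextual
  have hr : ∑ e with e.1.1 ≤ s ∧ e.1.2 ≤ t, u e ≤ rightCount u t :=
    Finset.sum_le_sum_of_subset fun e => by simp +contextual
  -- If both bounds were strict, an edge with left end at most `s` and right end beyond `t` would
  -- strictly enclose one with left end beyond `s` and right end at most `t`.
  by_contra hne
  have hl' : ∑ e with e.1.1 ≤ s ∧ e.1.2 ≤ t, u e < ∑ e with e.1.1 ≤ s, u e := by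
    change _ < leftCount u s
    omega
  have hr' : ∑ e with e.1.1 ≤ s ∧ e.1.2 ≤ t, u e < ∑ e with e.1.2 ≤ t, u e := by
    change _ < rightCount u t
    omega
  obtain ⟨e, he, he'⟩ : ∃ e ∈ u.support, e.1.1 ≤ s ∧ t < e.1.2 := by
    by_contra! hcon
    refine hl'.ne ?_
    rw [Finset.sum_filter, Finset.sum_filter]
    refine Finset.sum_congr rfl fun e _ => ?_
    by_cases h0 : u e = 0
    · simp [h0]
    · have := hcon e (by simpa using h0)
      rw [if_congr (and_iff_left_of_imp fun h => this h) rfl rfl]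
  obtain ⟨f, hf, hf'⟩ : ∃ f ∈ u.support, s < f.1.1 ∧ f.1.2 ≤ t := by
    by_contra! hcon
    refine hr'.ne ?_
    rw [Finset.sum_filter, Finset.sum_filter]
    refine Finset.sum_congr rfl fun e _ => ?_
    by_cases h0 : u e = 0
    · simp [h0]
    · have := hcon e (by simpa using h0)
      have h2 : e.1.2 ≤ t → e.1.1 ≤ s := fun h => by
        by_contra h'
        exact absurd h (not_le.mpr (this (not_le.mp h')))
      rw [if_congr (and_iff_right_of_imp h2) rfl rfl]
  have := (hu e he f hf).2 (he'.1.trans_lt hf'.1)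
  exact absurd (this.trans hf'.2) (not_le.mpr he'.2)

/-- Weakly crossing multisets of edges are determined by their vertex degrees. -/
theorem WeaklyCrossing.eq_of_vertexDegree_eq {u v : Edge p →₀ ℕ} (hu : WeaklyCrossing u)
    (hv : WeaklyCrossing v) (h : vertexDegree u = vertexDegree v) : u = v := by
  have hN := sum_eq_of_vertexDegree_eq h
  have hL : ∀ t, leftCount u t = leftCount v t := fun t => by
    rw [hu.leftCount_eq_min, hv.leftCount_eq_min, hN, leftCount_add_rightCount_eq h]
  have hR : ∀ t, rightCount u t = rightCount v t := fun t => by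
    have := leftCount_add_rightCount_eq h t
    have := hL t
    omega
  refine DFunLike.coe_injective (eq_of_sum_le_eq fun e => ?_)
  -- Edges carry the product order, so principal lower sets are the rectangles of `sum_le_eq_min`.
  have key : ∀ w : Edge p →₀ ℕ, ∑ f with f ≤ e, w f =
      ∑ f : Edge p with f.1.1 ≤ e.1.1 ∧ f.1.2 ≤ e.1.2, w f := fun w =>
    Finset.sum_congr (Finset.filter_congr fun f _ => Iff.rfl) fun _ _ => rfl
  rw [key, key, hu.sum_le_eq_min, hv.sum_le_eq_min, hL, hR]

/-! ## Uncrossing -/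

/-- `c` and `d` are the crossing edges on four vertices and `a`, `b` are the edges of one of the
two other perfect matchings on these vertices. -/
def Uncrosses (a b c d : Edge p) : Prop :=
  ∃ (i j k l : Fin p) (hij : i < j) (hjk : j < k) (hkl : k < l),
    ((a = ⟨(i, j), hij⟩ ∧ b = ⟨(k, l), hkl⟩) ∨
      (a = ⟨(i, l), (hij.trans hjk).trans hkl⟩ ∧ b = ⟨(j, k), hjk⟩)) ∧
    c = ⟨(i, k), hij.trans hjk⟩ ∧ d = ⟨(j, l), hjk.trans hkl⟩

/-- The edges of the complete graph on `A`. -/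
def edgesIn (A : Finset (Fin p)) : Set (Edge p) := {e | e.1.1 ∈ A ∧ e.1.2 ∈ A}

lemma Uncrosses.ne {a b c d : Edge p} (h : Uncrosses a b c d) : a ≠ b := by
  obtain ⟨i, j, k, l, hij, hjk, hkl, (⟨rfl, rfl⟩ | ⟨rfl, rfl⟩), rfl, rfl⟩ := h <;>
  · simp only [ne_eq, Subtype.mk.injEq, Prod.mk.injEq, not_and]
    intro h
    omega

lemma Uncrosses.edgesIn {A : Finset (Fin p)} {a b c d : Edge p} (h : Uncrosses a b c d)
    (ha : a ∈ edgesIn A) (hb : b ∈ edgesIn A) : c ∈ edgesIn A ∧ d ∈ edgesIn A := by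
  obtain ⟨i, j, k, l, hij, hjk, hkl, (⟨rfl, rfl⟩ | ⟨rfl, rfl⟩), rfl, rfl⟩ := h <;>
  · simp only [SparseFactor.edgesIn, Set.mem_ofPred_eq] at *
    tauto

lemma Uncrosses.vertexDegree_eq {a b c d : Edge p} (h : Uncrosses a b c d) :
    vertexDegree (Finsupp.single a 1 + Finsupp.single b 1) =
      vertexDegree (Finsupp.single c 1 + Finsupp.single d 1) := by
  simp only [map_add, vertexDegree_single, one_smul]
  obtain ⟨i, j, k, l, hij, hjk, hkl, (⟨rfl, rfl⟩ | ⟨rfl, rfl⟩), rfl, rfl⟩ := h <;>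
  · dsimp only
    abel

/-- The two conditions of weak crossing fail in two ways: `f` lies strictly inside `e`, or entirely
to its left. -/
lemma exists_uncrosses_of_not_weaklyCrossing {u : Edge p →₀ ℕ} (hu : ¬ WeaklyCrossing u) :
    ∃ a ∈ u.support, ∃ b ∈ u.support, ∃ c d, Uncrosses a b c d := by
  simp only [WeaklyCrossing, not_forall] at hu
  obtain ⟨e, he, f, hf, h⟩ := hu
  by_cases h1 : e.1.1 ≤ f.1.2
  · have h2 : e.1.1 < f.1.1 ∧ f.1.2 < e.1.2 := by
      by_contra h3
      exact h ⟨h1, fun h4 => not_lt.mp fun h5 => h3 ⟨h4, h5⟩⟩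
    exact ⟨e, he, f, hf, _, _, e.1.1, f.1.1, f.1.2, e.1.2, h2.1, f.2, h2.2,
      Or.inr ⟨rfl, rfl⟩, rfl, rfl⟩
  · exact ⟨f, hf, e, he, _, _, f.1.1, f.1.2, e.1.1, e.1.2, f.2, not_le.mp h1, e.2,
      Or.inl ⟨rfl, rfl⟩, rfl, rfl⟩

lemma single_add_single_le {α : Type*} {a b : α} (hab : a ≠ b) {u : α →₀ ℕ}
    (ha : a ∈ u.support) (hb : b ∈ u.support) :
    Finsupp.single a 1 + Finsupp.single b 1 ≤ u := by
  classical
  intro t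
  rw [Finsupp.mem_support_iff] at ha hb
  simp only [Finsupp.add_apply, Finsupp.single_apply]
  split_ifs with h1 h2 h2
  · exact absurd (h1.trans h2.symm) hab
  · subst h1; omega
  · subst h2; omega
  · omega

/-- The crossing pair is smaller than the other two pairs, on the vertex set `A`. -/
def CrossingLT (A : Finset (Fin p)) (m : MonomialOrder (Edge p)) : Prop :=
  ∀ a b c d, Uncrosses a b c d → a ∈ edgesIn A → b ∈ edgesIn A →
    (Finsupp.single c 1 + Finsupp.single d 1) ≺[m] (Finsupp.single a 1 + Finsupp.single b 1)

/-- A weakly crossing monomial is the smallest one among those with the same vertex degrees. -/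
theorem WeaklyCrossing.le_of_vertexDegree_eq {A : Finset (Fin p)} {m : MonomialOrder (Edge p)}
    (hm : CrossingLT A m) {u : Edge p →₀ ℕ} (hu : WeaklyCrossing u) (v : Edge p →₀ ℕ)
    (hv : (v.support : Set (Edge p)) ⊆ edgesIn A) (h : vertexDegree v = vertexDegree u) :
    u ≼[m] v := by
  classical
  induction hs : m.toSyn v using WellFoundedLT.induction generalizing v with
  | ind s ih =>
    subst hs
    by_cases hcv : WeaklyCrossing v
    · rw [hu.eq_of_vertexDegree_eq hcv h.symm]
    obtain ⟨a, ha, b, hb, c, d, hun⟩ := exists_uncrosses_of_not_weaklyCrossing hcv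
    obtain ⟨w, rfl⟩ := exists_add_of_le (single_add_single_le hun.ne ha hb)
    have hlt := hm a b c d hun (hv ha) (hv hb)
    have hlt' : ((Finsupp.single c 1 + Finsupp.single d 1) + w) ≺[m]
        ((Finsupp.single a 1 + Finsupp.single b 1) + w) := by
      rw [map_add _ _ w, map_add _ _ w]
      exact add_lt_add_left hlt _
    -- The traded monomial is smaller, still lives on `A` and has the same degrees, so the induction
    -- applies to it.
    refine (ih _ hlt' _ ?_ ?_ rfl).trans hlt'.le
    · intro t ht
      obtain ⟨hc, hd⟩ := hun.edgesIn (hv ha) (hv hb)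
      by_cases htw : w t = 0
      · by_cases htc : c = t
        · exact htc ▸ hc
        by_cases htd : d = t
        · exact htd ▸ hd
        simp [htw, htc, htd] at ht
      · refine hv ?_
        simp [htw]
    · rw [← h, map_add, map_add _ _ w, hun.vertexDegree_eq]

/-! ## Circular term orders prefer non-crossing pairs -/

/-- The block of `a` decides: all earlier blocks are empty on both sides, and in this one `c` and
`d` contribute nothing. -/
lemma IsBlockOrderOn.single_add_single_lt {τ : Type*} {m : MonomialOrder τ} {T : Set τ}
    {cl : τ → ℕ} (hm : IsBlockOrderOn m T cl) {a b c d : τ} (ha : a ∈ T) (hb : b ∈ T)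
    (hc : c ∈ T) (hd : d ∈ T) (hab : cl a ≤ cl b) (hac : cl a < cl c) (had : cl a < cl d) :
    (Finsupp.single c 1 + Finsupp.single d 1) ≺[m] (Finsupp.single a 1 + Finsupp.single b 1) := by
  classical
  have hsupp : ∀ {x y : τ}, x ∈ T → y ∈ T →
      ((Finsupp.single x 1 + Finsupp.single y 1 : τ →₀ ℕ).support : Set τ) ⊆ T := by
    intro x y hx hy t ht
    by_cases hxt : x = t
    · exact hxt ▸ hx
    by_cases hyt : y = t
    · exact hyt ▸ hy
    simp [hxt, hyt] at ht
  have hne : ∀ {x t : τ}, cl t < cl x → Finsupp.single x 1 t = (0 : ℕ) := fun {x t} h =>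
    Finsupp.single_eq_of_ne (by rintro rfl; exact lt_irrefl _ h)
  refine hm (cl a) _ _ (hsupp hc hd) (hsupp ha hb) (fun t ht => ?_) ?_
  · simp [hne ht, hne (ht.trans_le hab), hne (ht.trans hac), hne (ht.trans had)]
  · have h0 : Finsupp.filter (fun t => cl t = cl a)
        (Finsupp.single c 1 + Finsupp.single d 1 : τ →₀ ℕ) = 0 := by
      rw [Finsupp.filter_eq_zero_iff]
      intro t ht
      simp [hne (ht ▸ hac), hne (ht ▸ had)]
    rw [h0, map_zero, m.toSyn_lt_iff_ne_zero, ne_eq, m.toSyn_eq_zero_iff]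
    intro h
    have := DFunLike.congr_fun h a
    simp at this

lemma card_filter_Ico_add (S : Finset (Fin p)) {i j k : Fin p} (hij : i ≤ j) (hjk : j ≤ k) :
    (S.filter (fun v => i ≤ v ∧ v < k)).card =
      (S.filter (fun v => i ≤ v ∧ v < j)).card + (S.filter (fun v => j ≤ v ∧ v < k)).card := by
  rw [← Finset.card_union_of_disjoint]
  · congr 1
    ext v
    simp only [Finset.mem_filter, Finset.mem_union]
    constructor
    · rintro ⟨h, h1, h2⟩
      rcases lt_or_ge v j with h3 | h3
      · exact Or.inl ⟨h, h1, h3⟩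
      · exact Or.inr ⟨h, h3, h2⟩
    · rintro (⟨h, h1, h2⟩ | ⟨h, h1, h2⟩)
      · exact ⟨h, h1, h2.trans_le hjk⟩
      · exact ⟨h, hij.trans h1, h2⟩
  · rw [Finset.disjoint_left]
    intro v h1 h2
    simp only [Finset.mem_filter] at h1 h2
    exact absurd h1.2.2 (not_lt.mpr h2.2.1)

lemma card_filter_Ico_pos {S : Finset (Fin p)} {i j : Fin p} (hi : i ∈ S) (hij : i < j) :
    0 < (S.filter (fun v => i ≤ v ∧ v < j)).card :=
  Finset.card_pos.mpr ⟨i, by simp [hi, hij]⟩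

lemma card_filter_Ico_lt {S : Finset (Fin p)} {i j : Fin p} (hj : j ∈ S) :
    (S.filter (fun v => i ≤ v ∧ v < j)).card < S.card :=
  Finset.card_lt_card (Finset.filter_ssubset.mpr ⟨j, hj, by simp⟩)

/-- Four vertices cut the polygon into four nonempty arcs. A non-crossing pair spans two opposite
arcs, and each side of a diagonal is one of these two arcs plus a neighbouring arc. So the shorter
edge of the pair is strictly shorter than both diagonals. -/
lemma IsCircularTermOrder.crossingLT {S : Finset (Fin p)} {m : MonomialOrder (Edge p)}
    (hm : IsCircularTermOrder S m) : CrossingLT S m := by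
  intro a b c d hun ha hb
  obtain ⟨hc, hd⟩ := hun.edgesIn ha hb
  have key : (edgeClass S a ≤ edgeClass S b ∧ edgeClass S a < edgeClass S c ∧
      edgeClass S a < edgeClass S d) ∨ (edgeClass S b ≤ edgeClass S a ∧
      edgeClass S b < edgeClass S c ∧ edgeClass S b < edgeClass S d) := by
    obtain ⟨i, j, k, l, hij, hjk, hkl, h, rfl, rfl⟩ := hun
    have hi : i ∈ S := hc.1
    have hj : j ∈ S := hd.1
    have hk : k ∈ S := hc.2
    have h1 := card_filter_Ico_add S hij.le hjk.le
    have h2 := card_filter_Ico_add S hjk.le hkl.le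
    have h3 := card_filter_Ico_add S hij.le (hjk.trans hkl).le
    have h4 := card_filter_Ico_pos hi hij
    have h5 := card_filter_Ico_pos hj hjk
    have h6 := card_filter_Ico_pos hk hkl
    -- The arc from `l` back to `i` is nonempty because `l` itself is not counted.
    have h7 : (S.filter (fun v => i ≤ v ∧ v < l)).card < S.card := card_filter_Ico_lt hd.2
    rcases h with (⟨rfl, rfl⟩ | ⟨rfl, rfl⟩) <;>
    · simp only [edgeClass]
      omega
  rcases key with ⟨h1, h2, h3⟩ | ⟨h1, h2, h3⟩
  · exact IsBlockOrderOn.single_add_single_lt hm ha hb hc hd h1 h2 h3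
  · rw [add_comm (Finsupp.single a 1)]
    exact IsBlockOrderOn.single_add_single_lt hm hb ha hc hd h1 h2 h3

lemma CrossingLT.mono {A S : Finset (Fin p)} {m : MonomialOrder (Edge p)} (hAS : A ⊆ S)
    (hm : CrossingLT S m) : CrossingLT A m := fun a b c d h ha hb =>
  hm a b c d h ⟨hAS ha.1, hAS ha.2⟩ ⟨hAS hb.1, hAS hb.2⟩

/-! ## The parametrization -/

/-- The parametrization `σ_ij ↦ t_i t_j`, where `t_v = 0` for `v ∉ A`. -/
noncomputable def parametrization (A : Finset (Fin p)) :
    MvPolynomial (Edge p) ℝ →ₐ[ℝ] MvPolynomial (Fin p) ℝ :=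
  aeval fun e => (if e.1.1 ∈ A then X e.1.1 else 0) * (if e.1.2 ∈ A then X e.1.2 else 0)

lemma factorModel_apply_of_ne {A : Finset (Fin p)} {S : Matrix (Fin p) (Fin p) ℝ}
    (hS : S ∈ factorModel (H := Unit) (fun _ v => v ∈ A)) :
    ∃ t : Fin p → ℝ, (∀ v ∉ A, t v = 0) ∧ ∀ i j, i ≠ j → S i j = t i * t j := by
  obtain ⟨ω, -, Λ, hΛ, rfl⟩ := hS
  exact ⟨fun v => Λ v (), fun v hv => hΛ v () hv, fun i j hij => by
    simp [Matrix.mul_apply, Matrix.diagonal_apply_ne _ hij]⟩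

lemma mem_oneFactorIdeal_iff_forall {A : Finset (Fin p)} {f : MvPolynomial (Edge p) ℝ} :
    f ∈ oneFactorIdeal A ↔ ∀ t : Fin p → ℝ, (∀ v ∉ A, t v = 0) →
      aeval (fun e : Edge p => t e.1.1 * t e.1.2) f = 0 := by
  rw [oneFactorIdeal, idealOfInvariants, mem_vanishingIdeal_iff, Set.forall_mem_image]
  constructor
  · intro h t ht
    -- The diagonal part is invisible to the `σ_ij`, so any positive choice works.
    have hmem : (Matrix.diagonal (fun _ => (1 : ℝ)) +
        Matrix.of (fun v (_ : Unit) => t v) * (Matrix.of (fun v (_ : Unit) => t v)).transpose) ∈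
        factorModel (H := Unit) (fun _ v => v ∈ A) :=
      ⟨_, fun _ => one_pos, _, fun v _ hv => ht v hv, rfl⟩
    rw [← h hmem]
    congr 2
    funext e
    simp [Matrix.mul_apply, Matrix.one_apply_ne e.2.ne]
  · intro h S hS
    obtain ⟨t, ht, hSt⟩ := factorModel_apply_of_ne hS
    rw [← h t ht]
    congr 2
    funext e
    exact hSt _ _ e.2.ne

/-- A real polynomial vanishing at every point is zero, and setting the coordinates outside `A` to
zero turns any point into an admissible `t`. -/
lemma mem_oneFactorIdeal_iff {A : Finset (Fin p)} {f : MvPolynomial (Edge p) ℝ} :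
    f ∈ oneFactorIdeal A ↔ parametrization A f = 0 := by
  have heval : ∀ x : Fin p → ℝ, eval x (parametrization A f) =
      aeval (fun e : Edge p => (if e.1.1 ∈ A then x e.1.1 else 0) *
        (if e.1.2 ∈ A then x e.1.2 else 0)) f := by
    intro x
    have : (aeval x).comp (parametrization A) =
        aeval (fun e : Edge p => (if e.1.1 ∈ A then x e.1.1 else 0) *
          (if e.1.2 ∈ A then x e.1.2 else 0)) := by
      ext e
      by_cases h1 : e.1.1 ∈ A <;> by_cases h2 : e.1.2 ∈ A <;> simp [parametrization, h1, h2]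
    rw [← this, AlgHom.comp_apply]
    rfl
  rw [mem_oneFactorIdeal_iff_forall]
  constructor
  · intro h
    refine MvPolynomial.funext fun x => ?_
    rw [heval, map_zero]
    exact h (fun v => if v ∈ A then x v else 0) fun v hv => if_neg hv
  · intro h t ht
    have := heval t
    rw [h, map_zero] at this
    rw [this]
    have ht' : ∀ v, (if v ∈ A then t v else 0) = t v := fun v => by
      split_ifs with hv
      · rfl
      · exact (ht v hv).symm
    simp only [ht']

lemma parametrization_X_of_mem {A : Finset (Fin p)} {e : Edge p} (he : e ∈ edgesIn A) :
    parametrization A (X e) = monomial (vertexDegree (Finsupp.single e 1)) 1 := by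
  rw [parametrization, aeval_X, if_pos he.1, if_pos he.2, X, X, monomial_mul, one_mul,
    vertexDegree_single, one_smul]

lemma parametrization_X_of_notMem {A : Finset (Fin p)} {e : Edge p} (he : e ∉ edgesIn A) :
    parametrization A (X e) = 0 := by
  rw [parametrization, aeval_X]
  by_cases h : e.1.1 ∈ A
  · rw [if_neg fun h2 => he ⟨h, h2⟩, mul_zero]
  · rw [if_neg h, zero_mul]

lemma parametrization_monomial_of_subset {A : Finset (Fin p)} {u : Edge p →₀ ℕ}
    (hu : (u.support : Set (Edge p)) ⊆ edgesIn A) (c : ℝ) :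
    parametrization A (monomial u c) = monomial (vertexDegree u) c := by
  rw [monomial_eq, map_mul, Finsupp.prod, map_prod, algHom_C,
    vertexDegree, Finsupp.linearCombination_apply, monomial_finsupp_sum_index, Finsupp.prod]
  congr 1
  refine Finset.prod_congr rfl fun e he => ?_
  rw [map_pow, parametrization_X_of_mem (hu he), vertexDegree_single, one_smul, monomial_pow,
    one_pow]

lemma parametrization_monomial_of_not_subset {A : Finset (Fin p)} {u : Edge p →₀ ℕ}
    (hu : ¬ (u.support : Set (Edge p)) ⊆ edgesIn A) (c : ℝ) :
    parametrization A (monomial u c) = 0 := by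
  obtain ⟨e, he, heA⟩ := Set.not_subset.mp hu
  obtain ⟨q, hq⟩ : X e ∣ monomial u c :=
    X_dvd_monomial.mpr (Or.inr (Finsupp.mem_support_iff.mp he))
  rw [hq, map_mul, parametrization_X_of_notMem heA, zero_mul]

/-- A monomial of a polynomial in the ideal that only involves edges on `A` shares its vertex
degrees with another such monomial. -/
lemma exists_ne_vertexDegree_eq {A : Finset (Fin p)} {f : MvPolynomial (Edge p) ℝ}
    (hf : f ∈ oneFactorIdeal A) {u : Edge p →₀ ℕ} (hu : u ∈ f.support)
    (huA : (u.support : Set (Edge p)) ⊆ edgesIn A) :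
    ∃ v ∈ f.support, v ≠ u ∧ (v.support : Set (Edge p)) ⊆ edgesIn A ∧
      vertexDegree v = vertexDegree u := by
  classical
  by_contra! hcon
  rw [mem_oneFactorIdeal_iff, f.as_sum, map_sum] at hf
  -- If `u` were alone in its fibre, the coefficient at its degree sequence would be that of `u` in
  -- `f`.
  have hc := congrArg (coeff (vertexDegree u)) hf
  rw [coeff_sum, coeff_zero, Finset.sum_eq_single_of_mem u hu,
    parametrization_monomial_of_subset huA, coeff_monomial, if_pos rfl] at hc
  · exact mem_support_iff.mp hu hc
  · intro v hv hvu
    by_cases hvA : (v.support : Set (Edge p)) ⊆ edgesIn A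
    · rw [parametrization_monomial_of_subset hvA, coeff_monomial, if_neg (hcon v hv hvu hvA)]
    · rw [parametrization_monomial_of_not_subset hvA, coeff_zero]

/-- The leading monomial of a nonzero polynomial in the ideal involves an edge outside `A` or is
not weakly crossing. -/
theorem not_weaklyCrossing_degree {A : Finset (Fin p)} {m : MonomialOrder (Edge p)}
    (hm : CrossingLT A m) {f : MvPolynomial (Edge p) ℝ} (hf : f ∈ oneFactorIdeal A) (hf0 : f ≠ 0)
    (hA : ((m.degree f).support : Set (Edge p)) ⊆ edgesIn A) :
    ¬ WeaklyCrossing (m.degree f) := by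
  intro hw
  obtain ⟨v, hv, hne, hvA, hdeg⟩ := exists_ne_vertexDegree_eq hf (m.degree_mem_support hf0) hA
  exact hne (m.toSyn.injective
    (le_antisymm (m.le_degree hv) (hw.le_of_vertexDegree_eq hm v hvA hdeg)))

/-! ## The Gröbner basis -/

lemma X_mul_X_eq_monomial (a b : Edge p) :
    (X a * X b : MvPolynomial (Edge p) ℝ) =
      monomial (Finsupp.single a 1 + Finsupp.single b 1) 1 := by
  rw [X, X, monomial_mul, one_mul]

/-- Puts both kinds of tetrad into one binomial form, so that later arguments need not separate
them. -/
lemma mem_tetrads_iff {A : Finset (Fin p)} {f : MvPolynomial (Edge p) ℝ} :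
    f ∈ tetrads A ↔ ∃ a b c d, Uncrosses a b c d ∧ a ∈ edgesIn A ∧ b ∈ edgesIn A ∧
      f = X a * X b - X c * X d := by
  constructor
  · rintro ⟨i, j, k, l, hij, hjk, hkl, ⟨hi, hj, hk, hl⟩, rfl | rfl⟩
    · exact ⟨_, _, _, _, ⟨i, j, k, l, hij, hjk, hkl, Or.inl ⟨rfl, rfl⟩, rfl, rfl⟩,
        ⟨hi, hj⟩, ⟨hk, hl⟩, rfl⟩
    · exact ⟨_, _, _, _, ⟨i, j, k, l, hij, hjk, hkl, Or.inr ⟨rfl, rfl⟩, rfl, rfl⟩,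
        ⟨hi, hl⟩, ⟨hj, hk⟩, rfl⟩
  · rintro ⟨a, b, c, d, ⟨i, j, k, l, hij, hjk, hkl, (⟨rfl, rfl⟩ | ⟨rfl, rfl⟩), rfl, rfl⟩,
      ha, hb, rfl⟩
    · exact ⟨i, j, k, l, hij, hjk, hkl, ⟨ha.1, ha.2, hb.1, hb.2⟩, Or.inl rfl⟩
    · exact ⟨i, j, k, l, hij, hjk, hkl, ⟨ha.1, hb.1, hb.2, ha.2⟩, Or.inr rfl⟩

lemma mem_degreeOneMonomials_iff {A : Finset (Fin p)} {f : MvPolynomial (Edge p) ℝ} :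
    f ∈ degreeOneMonomials Aᶜ ↔ ∃ e ∉ edgesIn A, f = X e := by
  constructor
  · rintro ⟨i, j, h, hB, rfl⟩
    refine ⟨⟨(i, j), h⟩, fun hA => ?_, rfl⟩
    simp only [Finset.mem_compl] at hB
    exact hB.elim (fun h => h hA.1) (fun h => h hA.2)
  · rintro ⟨e, he, rfl⟩
    refine ⟨e.1.1, e.1.2, e.2, ?_, rfl⟩
    simp only [Finset.mem_compl]
    by_contra! h
    exact he h

section Tetrad

variable {A : Finset (Fin p)} {m : MonomialOrder (Edge p)} {a b c d : Edge p}

lemma CrossingLT.degree_lt (hm : CrossingLT A m) (h : Uncrosses a b c d) (ha : a ∈ edgesIn A)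
    (hb : b ∈ edgesIn A) :
    m.degree (X c * X d : MvPolynomial (Edge p) ℝ) ≺[m]
      m.degree (X a * X b : MvPolynomial (Edge p) ℝ) := by
  classical
  rw [X_mul_X_eq_monomial, X_mul_X_eq_monomial, m.degree_monomial, m.degree_monomial,
    if_neg one_ne_zero, if_neg one_ne_zero]
  exact hm a b c d h ha hb

lemma CrossingLT.degree_tetrad (hm : CrossingLT A m) (h : Uncrosses a b c d)
    (ha : a ∈ edgesIn A) (hb : b ∈ edgesIn A) :
    m.degree (X a * X b - X c * X d : MvPolynomial (Edge p) ℝ) =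
      Finsupp.single a 1 + Finsupp.single b 1 := by
  classical
  rw [m.degree_sub_of_lt (hm.degree_lt h ha hb), X_mul_X_eq_monomial, m.degree_monomial,
    if_neg one_ne_zero]

lemma CrossingLT.leadingCoeff_tetrad (hm : CrossingLT A m) (h : Uncrosses a b c d)
    (ha : a ∈ edgesIn A) (hb : b ∈ edgesIn A) :
    m.leadingCoeff (X a * X b - X c * X d : MvPolynomial (Edge p) ℝ) = 1 := by
  rw [m.leadingCoeff_sub_of_lt (hm.degree_lt h ha hb), X_mul_X_eq_monomial,
    m.leadingCoeff_monomial]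

lemma CrossingLT.leadingTerm_tetrad (hm : CrossingLT A m) (h : Uncrosses a b c d)
    (ha : a ∈ edgesIn A) (hb : b ∈ edgesIn A) :
    m.leadingTerm (X a * X b - X c * X d : MvPolynomial (Edge p) ℝ) = X a * X b := by
  rw [MonomialOrder.leadingTerm, hm.degree_tetrad h ha hb, hm.leadingCoeff_tetrad h ha hb,
    X_mul_X_eq_monomial]

end Tetrad

lemma tetrads_subset_oneFactorIdeal (A : Finset (Fin p)) :
    tetrads A ⊆ (oneFactorIdeal A : Set (MvPolynomial (Edge p) ℝ)) := by
  intro f hf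
  obtain ⟨a, b, c, d, h, ha, hb, rfl⟩ := mem_tetrads_iff.mp hf
  obtain ⟨hc, hd⟩ := h.edgesIn ha hb
  rw [SetLike.mem_coe, mem_oneFactorIdeal_iff, map_sub, map_mul, map_mul,
    parametrization_X_of_mem ha, parametrization_X_of_mem hb, parametrization_X_of_mem hc,
    parametrization_X_of_mem hd, monomial_mul, monomial_mul, ← map_add, ← map_add,
    h.vertexDegree_eq, sub_self]

lemma degreeOneMonomials_subset_oneFactorIdeal (A : Finset (Fin p)) :
    degreeOneMonomials Aᶜ ⊆ (oneFactorIdeal A : Set (MvPolynomial (Edge p) ℝ)) := by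
  intro f hf
  obtain ⟨e, he, rfl⟩ := mem_degreeOneMonomials_iff.mp hf
  rw [SetLike.mem_coe, mem_oneFactorIdeal_iff, parametrization_X_of_notMem he]

lemma finite_degreeOneMonomials_union_tetrads (A : Finset (Fin p)) :
    (degreeOneMonomials Aᶜ ∪ tetrads A).Finite := by
  refine Set.Finite.union ?_ ?_
  · refine (Set.finite_range (fun e : Edge p => (X e : MvPolynomial (Edge p) ℝ))).subset ?_
    intro f hf
    obtain ⟨e, -, rfl⟩ := mem_degreeOneMonomials_iff.mp hf
    exact ⟨e, rfl⟩
  · refine (Set.finite_range (fun q : Edge p × Edge p × Edge p × Edge p =>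
      (X q.1 * X q.2.1 - X q.2.2.1 * X q.2.2.2 : MvPolynomial (Edge p) ℝ))).subset ?_
    intro f hf
    obtain ⟨a, b, c, d, -, -, -, rfl⟩ := mem_tetrads_iff.mp hf
    exact ⟨(a, b, c, d), rfl⟩

theorem CrossingLT.isGroebnerBasis {A : Finset (Fin p)} {m : MonomialOrder (Edge p)}
    (hm : CrossingLT A m) :
    IsGroebnerBasis m (degreeOneMonomials Aᶜ ∪ tetrads A) (oneFactorIdeal A) := by
  have hsub : degreeOneMonomials Aᶜ ∪ tetrads A ⊆
      (oneFactorIdeal A : Set (MvPolynomial (Edge p) ℝ)) :=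
    Set.union_subset (degreeOneMonomials_subset_oneFactorIdeal A)
      (tetrads_subset_oneFactorIdeal A)
  refine ⟨finite_degreeOneMonomials_union_tetrads A, hsub,
    le_antisymm (Ideal.span_mono (Set.image_mono hsub)) ?_⟩
  rw [Ideal.span_le]
  rintro _ ⟨f, hf, rfl⟩
  by_cases hf0 : f = 0
  · rw [hf0, m.leadingTerm_zero]
    exact zero_mem _
  by_cases hA : ((m.degree f).support : Set (Edge p)) ⊆ edgesIn A
  · obtain ⟨a, ha, b, hb, c, d, h⟩ :=
      exists_uncrosses_of_not_weaklyCrossing (not_weaklyCrossing_degree hm hf hf0 hA)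
    refine Ideal.mem_of_dvd _ ?_ (Ideal.subset_span ⟨X a * X b - X c * X d,
      Or.inr (mem_tetrads_iff.mpr ⟨a, b, c, d, h, hA ha, hA hb, rfl⟩), rfl⟩)
    rw [hm.leadingTerm_tetrad h (hA ha) (hA hb), X_mul_X_eq_monomial]
    exact monomial_dvd_monomial.mpr ⟨Or.inr (single_add_single_le h.ne ha hb), one_dvd _⟩
  · obtain ⟨e, he, heA⟩ := Set.not_subset.mp hA
    refine Ideal.mem_of_dvd _ ?_ (Ideal.subset_span ⟨X e,
      Or.inl (mem_degreeOneMonomials_iff.mpr ⟨e, heA, rfl⟩), rfl⟩)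
    rw [X, m.leadingTerm_monomial]
    exact X_dvd_monomial.mpr (Or.inr (Finsupp.mem_support_iff.mp he))

/-! ## Reducedness -/

lemma eq_or_eq_of_single_add_single_apply_ne_zero {α : Type*} {a b t : α}
    (h : (Finsupp.single a 1 + Finsupp.single b 1 : α →₀ ℕ) t ≠ 0) : t = a ∨ t = b := by
  classical
  by_contra! hcon
  exact h (by simp [hcon.1, hcon.2])

lemma eq_or_eq_of_single_add_single_le {α : Type*} {a b x y : α}
    (h : (Finsupp.single a 1 + Finsupp.single b 1 : α →₀ ℕ) ≤
      Finsupp.single x 1 + Finsupp.single y 1) : (a = x ∨ a = y) ∧ (b = x ∨ b = y) := by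
  classical
  refine ⟨eq_or_eq_of_single_add_single_apply_ne_zero ?_,
    eq_or_eq_of_single_add_single_apply_ne_zero ?_⟩
  · have := h a
    rw [Finsupp.add_apply, Finsupp.single_eq_same] at this
    omega
  · have := h b
    rw [Finsupp.add_apply, Finsupp.single_eq_same (a := b)] at this
    omega

/-- A tetrad is determined by the pair of edges in its leading term. -/
lemma Uncrosses.unique {a b c d a' b' c' d' : Edge p} (h : Uncrosses a b c d)
    (h' : Uncrosses a' b' c' d') (ha : a' = a ∨ a' = b) (hb : b' = a ∨ b' = b) :
    a' = a ∧ b' = b ∧ c' = c ∧ d' = d := by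
  obtain ⟨i, j, k, l, hij, hjk, hkl, (⟨rfl, rfl⟩ | ⟨rfl, rfl⟩), rfl, rfl⟩ := h <;>
  obtain ⟨i', j', k', l', hij', hjk', hkl', (⟨rfl, rfl⟩ | ⟨rfl, rfl⟩), rfl, rfl⟩ := h' <;>
  · simp only [Subtype.mk.injEq, Prod.mk.injEq] at *
    omega

/-- The leading term of a tetrad is not the other term of a tetrad. -/
lemma Uncrosses.not_crossing {a b c d a' b' c' d' : Edge p} (h : Uncrosses a b c d)
    (h' : Uncrosses a' b' c' d') : ¬ ((a' = c ∨ a' = d) ∧ (b' = c ∨ b' = d)) := by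
  obtain ⟨i, j, k, l, hij, hjk, hkl, -, rfl, rfl⟩ := h
  obtain ⟨i', j', k', l', hij', hjk', hkl', (⟨rfl, rfl⟩ | ⟨rfl, rfl⟩), rfl, rfl⟩ := h' <;>
  · simp only [Subtype.mk.injEq, Prod.mk.injEq]
    omega

lemma mem_support_tetrad {a b c d : Edge p} {u : Edge p →₀ ℕ}
    (hu : u ∈ (X a * X b - X c * X d : MvPolynomial (Edge p) ℝ).support) :
    u = Finsupp.single a 1 + Finsupp.single b 1 ∨ u = Finsupp.single c 1 + Finsupp.single d 1 := by
  classical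
  rw [X_mul_X_eq_monomial, X_mul_X_eq_monomial] at hu
  rcases Finset.mem_union.mp (support_sub _ _ _ hu) with h | h
  · exact Or.inl (Finset.mem_singleton.mp (support_monomial_subset h))
  · exact Or.inr (Finset.mem_singleton.mp (support_monomial_subset h))

/-- Tetrads involve only edges on `A`, so they do not interact with the degree-one generators.
Between tetrads, divisibility forces equal pairs of edges; a non-crossing pair determines its
tetrad, and a crossing pair is never a leading one. -/
theorem CrossingLT.isReducedGroebnerBasis {A : Finset (Fin p)} {m : MonomialOrder (Edge p)}
    (hm : CrossingLT A m) :
    IsReducedGroebnerBasis m (degreeOneMonomials Aᶜ ∪ tetrads A) (oneFactorIdeal A) := by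
  classical
  have hmonic : ∀ g ∈ degreeOneMonomials Aᶜ ∪ tetrads A, m.leadingCoeff g = 1 := by
    rintro g (hg | hg)
    · obtain ⟨e, -, rfl⟩ := mem_degreeOneMonomials_iff.mp hg
      exact m.leadingCoeff_monomial 1
    · obtain ⟨a, b, c, d, h, ha, hb, rfl⟩ := mem_tetrads_iff.mp hg
      exact hm.leadingCoeff_tetrad h ha hb
  refine ⟨hm.isGroebnerBasis, fun g hg => ⟨?_, hmonic g hg⟩, ?_⟩
  · rintro rfl
    simpa using hmonic _ hg
  intro g hg g' hg' hne u hu hle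
  have hA : g ∈ tetrads A → ∀ t, u t ≠ 0 → t ∈ edgesIn A := by
    intro hg t ht
    obtain ⟨a, b, c, d, h, ha, hb, rfl⟩ := mem_tetrads_iff.mp hg
    obtain ⟨hc, hd⟩ := h.edgesIn ha hb
    rcases mem_support_tetrad hu with rfl | rfl <;>
    rcases eq_or_eq_of_single_add_single_apply_ne_zero ht with rfl | rfl <;>
    assumption
  rcases hg' with hg' | hg'
  · obtain ⟨e', he', rfl⟩ := mem_degreeOneMonomials_iff.mp hg'
    rw [m.degree_X, Finsupp.single_le_iff] at hle
    rcases hg with hg | hg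
    · obtain ⟨e, he, rfl⟩ := mem_degreeOneMonomials_iff.mp hg
      rw [support_X, Finset.mem_singleton] at hu
      subst hu
      rw [Finsupp.single_apply] at hle
      split_ifs at hle with hee
      · exact hne (by rw [hee])
      · omega
    · exact he' (hA hg e' (by omega))
  · obtain ⟨a', b', c', d', h', ha', hb', rfl⟩ := mem_tetrads_iff.mp hg'
    rw [hm.degree_tetrad h' ha' hb'] at hle
    rcases hg with hg | hg
    · obtain ⟨e, he, rfl⟩ := mem_degreeOneMonomials_iff.mp hg
      rw [support_X, Finset.mem_singleton] at hu
      subst hu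
      have := hle a'
      rw [Finsupp.add_apply, Finsupp.single_eq_same,
        Finsupp.single_apply (a := e)] at this
      split_ifs at this with hee
      · exact he (hee ▸ ha')
      · omega
    · obtain ⟨a, b, c, d, h, ha, hb, rfl⟩ := mem_tetrads_iff.mp hg
      rcases mem_support_tetrad hu with rfl | rfl
      · obtain ⟨h1, h2⟩ := eq_or_eq_of_single_add_single_le hle
        obtain ⟨rfl, rfl, rfl, rfl⟩ := h.unique h' h1 h2
        exact hne rfl
      · exact h.not_crossing h' (eq_or_eq_of_single_add_single_le hle)

end SparseFactor

theorem mainTheorem7 {p : ℕ} (A : Finset (Fin p)) (m : MonomialOrder (SparseFactor.Edge p))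
    (hm : SparseFactor.IsCircularTermOrder Finset.univ m ∨
      SparseFactor.IsCircularTermOrder A m) :
    SparseFactor.IsReducedGroebnerBasis m
        (SparseFactor.degreeOneMonomials Aᶜ ∪ SparseFactor.tetrads A)
        (SparseFactor.oneFactorIdeal A) ∧
      ∀ (i j k l : Fin p) (hij : i < j) (hjk : j < k) (hkl : k < l),
        i ∈ A → j ∈ A → k ∈ A → l ∈ A →
          m.leadingTerm (SparseFactor.tetrad₁ i j k l hij hjk hkl) =
              SparseFactor.sig i j hij * SparseFactor.sig k l hkl ∧
            m.leadingTerm (SparseFactor.tetrad₂ i j k l hij hjk hkl) =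
              SparseFactor.sig i l ((hij.trans hjk).trans hkl) * SparseFactor.sig j k hjk := by
  -- Distances measured in `[p]` and in `A` differ, but the comparison of pairs passes from a vertex
  -- set to its subsets.
  have hA : SparseFactor.CrossingLT A m := by
    rcases hm with hm | hm
    · exact hm.crossingLT.mono (Finset.subset_univ A)
    · exact hm.crossingLT
  refine ⟨hA.isReducedGroebnerBasis, fun i j k l hij hjk hkl hi hj hk hl => ⟨?_, ?_⟩⟩
  · exact hA.leadingTerm_tetrad ⟨i, j, k, l, hij, hjk, hkl, Or.inl ⟨rfl, rfl⟩, rfl, rfl⟩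
      ⟨hi, hj⟩ ⟨hk, hl⟩
  · exact hA.leadingTerm_tetrad ⟨i, j, k, l, hij, hjk, hkl, Or.inr ⟨rfl, rfl⟩, rfl, rfl⟩
      ⟨hi, hl⟩ ⟨hj, hk⟩
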